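/- All cardinals are infinite. A cardinal is identified with its initial ordinal and, as a topological space, has the order topology; $\mu^{\kappa}$ denotes the product of $\kappa$ copies of $\mu$, with the Tychonoff topology. A topological space is $[\lambda,\lambda]$-compact if every open cover by at most $\lambda$ sets has a subcover by fewer than $\lambda$ sets. A stationary set $S\subseteq\lambda$ is nonreflecting if $S\cap\alpha$ is not stationary in $\alpha$ for every $\alpha<\lambda$ of uncountable cofinality. For regular $\mu<\lambda$, the principle $E^{\mu}_{\lambda}$ asserts that $\lambda$ has a nonreflecting stationary subset consisting of ordinals of cofinality $\mu$. The principle $\Box_\lambda$ asserts that there is a sequence $(C_\alpha)$, indexed by the limit ordinals $\alpha<\lambda^+$, such that each $C_\alpha$ is a closed unbounded subset of $\alpha$ of order type at most $\lambda$, and $C_\beta=C_\alpha\cap\beta$ whenever $\beta<\alpha$ is a limit point of $C_\alpha$. **Corollary.** (1) If $\mu<\lambda$ are regular cardinals and $E^{\mu}_{\lambda}$ holds, then $\mu^{\lambda}$ is not $[\lambda,\lambda]$-compact. (2) If $\lambda$ is an infinite cardinal and $\Box_\lambda$ holds, then $\mu^{\lambda^+}$ is not $[\lambda^+,\lambda^+]$-compact,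 for every regular cardinal $\mu\le\lambda$. -/

import Mathlib

open Cardinal Order

universe u

/-- An ordinal `o`, as the well-ordered type `o.ToType` of its elements, carries the order
topology. In particular so does a cardinal `μ`, identified with its initial ordinal `μ.ord`. -/
noncomputable instance Ordinal.instTopologicalSpaceToType (o : Ordinal.{u}) : TopologicalSpace o.ToType :=
  Preorder.topology o.ToType

instance Ordinal.instOrderTopologyToType (o : Ordinal.{u}) : OrderTopology o.ToType :=
  ⟨rfl⟩

/-- The power `μ ^ κ`: all functions from `κ` to `μ`, with the product (Tychonoff) topology, where
the factor `μ` has the order topology. -/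
abbrev CardinalPower (μ κ : Cardinal.{u}) : Type u :=
  κ.ord.ToType → μ.ord.ToType

/-- `X` is `[μ, κ]`-compact: every open cover of `X` by at most `κ` sets has a subcover by fewer
than `μ` sets. -/
def IsBracketCompact (μ κ : Cardinal.{u}) (X : Type u) [TopologicalSpace X] : Prop :=
  ∀ 𝒰 : Set (Set X), (∀ U ∈ 𝒰, IsOpen U) → ⋃₀ 𝒰 = Set.univ → #𝒰 ≤ κ →
    ∃ 𝒱 : Set (Set X), 𝒱 ⊆ 𝒰 ∧ ⋃₀ 𝒱 = Set.univ ∧ #𝒱 < μ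

/-- For a subset `S` of a linear order `α` (below: an ordinal) and `a : α`, the set
`S ∩ Set.Iio a`, seen as a subset of the initial segment `Set.Iio a`. -/
def traceBelow {α : Type u} [LinearOrder α] (S : Set α) (a : α) : Set (Set.Iio a) :=
  {x | (x : α) ∈ S}

/-- `S` is a nonreflecting stationary set: it is stationary, but `S ∩ a` is not stationary in `a`,
for every `a` of uncountable cofinality. -/
def IsNonreflectingStationary {α : Type u} [LinearOrder α] (S : Set α) : Prop :=
  IsStationary S ∧ ∀ a : α, ℵ₀ < Order.cof (Set.Iio a) → ¬ IsStationary (traceBelow S a)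

/-- The principle `E^μ_κ`: there is a nonreflecting stationary subset of `κ` which consists of
ordinals of cofinality `μ`. -/
def PrincipleE (μ κ : Cardinal.{u}) : Prop :=
  ∃ S : Set κ.ord.ToType, IsNonreflectingStationary S ∧ ∀ a ∈ S, Order.cof (Set.Iio a) = μ

/-- `b` is a limit point of the subset `C` of the ordinal `α`. -/
def IsLimitPointOf {α : Type u} [LinearOrder α] (C : Set α) (b : α) : Prop :=
  IsSuccLimit b ∧ ∀ c < b, ∃ d ∈ C, c < d ∧ d < b

/-- Jensen's square principle `□_κ`: there is a sequence `(C a)`, indexed by the limit ordinals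
`a < κ⁺` (the values of `C` at other ordinals play no role), such that `C a` is a closed unbounded
subset of `a`, of order type at most `κ`, and `C b = C a ∩ b` whenever `b < a` is a limit point
of `C a`. -/
def SquarePrinciple (κ : Cardinal.{u}) : Prop :=
  ∃ C : (succ κ).ord.ToType → Set (succ κ).ord.ToType,
    ∀ a, IsSuccLimit a →
      C a ⊆ Set.Iio a ∧
      IsClub (traceBelow (C a) a) ∧
      Ordinal.type (fun x y : C a => x < y) ≤ κ.ord ∧
      ∀ b < a, IsLimitPointOf (C a) b → C b = C a ∩ Set.Iio b

open Set

/-! ### Clubs, ladders and their separation in well-orders -/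

section WellOrder

variable {α : Type u} [LinearOrder α]

/-! Fix a ladder `c d`, a cofinal `μ`-sequence, at each `d ∈ S`. Since `S` does not reflect,
induction on `a` gives a function `r a` from `κ` to `μ` past whose values the ladders at points of
`S` up to `a` are separated (`exists_separating`). As points of `μ ^ κ`, the `r a` have no complete
accumulation point. Any `y` takes a constant value `j` on a stationary part of `S`, and there Fodor
(`IsStationary.exists_ne_eq_of_regressive`) gives `d < e` with `c d j = c e j`. Hence no `r a` with
`a ≥ e` satisfies both `r a d ≤ j` and `r a e ≤ j`, which is an open condition holding at `y`. The
complements of the closures of the tails then form the bad cover. Part (2) reduces to part (1),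
because square yields a nonreflecting stationary set in every regular cofinality `μ ≤ κ`
(`SquarePrinciple.principleE`). -/

theorem noMaxOrder_of_aleph0_le_cof (h : ℵ₀ ≤ Order.cof α) : NoMaxOrder α := by
  rw [aleph0_le_cof_iff] at h
  cases isEmpty_or_nonempty α
  · exact ⟨fun a => isEmptyElim a⟩
  · rw [one_lt_cof_iff] at h
    exact noTopOrder_iff_noMaxOrder α |>.1 h

theorem isSuccLimit_of_aleph0_le_cof_Iio {a : α} (h : ℵ₀ ≤ Order.cof (Iio a)) :
    IsSuccLimit a := by
  have := noMaxOrder_of_aleph0_le_cof h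
  have hne : Nonempty (Iio a) := by
    rw [← cof_ne_zero_iff]
    exact (aleph0_pos.trans_le h).ne'
  obtain ⟨⟨b, hb⟩⟩ := hne
  refine ⟨fun hm => hm.not_lt hb, fun x hx => ?_⟩
  obtain ⟨⟨y, hy⟩, hxy⟩ := exists_gt (⟨x, hx.lt⟩ : Iio a)
  exact hx.2 hxy hy

/-- If `S` does not reflect at `a`, then there is a cofinal subset of `a` that accumulates to no
point of `S` below `a`. -/
theorem exists_cofinal_nonaccumulating {S : Set α} (hlim : ∀ d ∈ S, IsSuccLimit d) (a : α)
    (hS : ℵ₀ < Order.cof (Iio a) → ¬ IsStationary (traceBelow S a)) :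
    ∃ E ⊆ Iio a, (∀ x < a, ∃ e ∈ E, x ≤ e) ∧
      ∀ d ∈ S, d < a → ∃ b < d, ∀ e ∈ E, e < d → e ≤ b := by
  rcases lt_or_ge ℵ₀ (Order.cof (Iio a)) with hcof | hcof
  · obtain ⟨t, ht, hdisj⟩ := not_isStationary_iff.1 (hS hcof)
    refine ⟨Subtype.val '' t, ?_, fun x hx => ?_, fun d hd hda => ?_⟩
    · rintro _ ⟨e, -, rfl⟩
      exact e.2
    · obtain ⟨e, he, hxe⟩ := ht.isCofinal ⟨x, hx⟩
      exact ⟨e, mem_image_of_mem _ he, hxe⟩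
    · by_contra! hacc
      suffices hdt : (⟨d, hda⟩ : Iio a) ∈ t from
        disjoint_left.1 hdisj (show (⟨d, hda⟩ : Iio a) ∈ traceBelow S a from hd) hdt
      have hne : (t ∩ Iio ⟨d, hda⟩).Nonempty := by
        obtain ⟨b, hb⟩ := not_isMin_iff.1 (hlim d hd).1
        obtain ⟨_, ⟨e, he, rfl⟩, hed, -⟩ := hacc b hb
        exact ⟨e, he, hed⟩
      refine ht.isLUB_mem inter_subset_left hne ⟨fun e he => le_of_lt he.2, fun b hb => ?_⟩
      by_contra! hbd
      obtain ⟨_, ⟨e, he, rfl⟩, hed, hbe⟩ := hacc b hbd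
      exact hbe.not_ge (hb ⟨he, hed⟩)
  · cases isEmpty_or_nonempty (Iio a) with
    | inl hemp =>
      exact ⟨∅, empty_subset _, fun x hx => hemp.elim ⟨x, hx⟩, fun d _ hda => hemp.elim ⟨d, hda⟩⟩
    | inr hne =>
      obtain ⟨s, hs, hs'⟩ := exists_cof_eq (Iio a)
      have hcount : s.Countable := by rw [← le_aleph0_iff_set_countable, hs']; exact hcof
      obtain ⟨f, rfl⟩ := hcount.exists_eq_range hs.nonempty
      -- Partial suprema make the sequence monotone: once a term reaches `d`, only the finitely many
      -- earlier terms can lie below `d`.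
      refine ⟨range fun n => (partialSups f n : α), ?_, fun x hx => ?_, fun d hd hda => ?_⟩
      · rintro _ ⟨n, rfl⟩
        exact (partialSups f n).2
      · obtain ⟨_, ⟨n, rfl⟩, hn⟩ := hs ⟨x, hx⟩
        exact ⟨_, ⟨n, rfl⟩, hn.trans (le_partialSups f n)⟩
      · obtain ⟨_, ⟨n, rfl⟩, hn⟩ := hs ⟨d, hda⟩
        obtain ⟨b₀, hb₀⟩ := not_isMin_iff.1 (hlim d hd).1
        have key (m : ℕ) : ∃ b < d, ∀ i < m, (partialSups f i : α) < d →
            (partialSups f i : α) ≤ b := by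
          induction m with
          | zero => exact ⟨b₀, hb₀, by simp⟩
          | succ m ih =>
            obtain ⟨b, hb, hbm⟩ := ih
            by_cases hm : (partialSups f m : α) < d
            · refine ⟨max b (partialSups f m), max_lt hb hm, fun i hi hid => ?_⟩
              rcases Nat.lt_succ_iff_lt_or_eq.1 hi with hi | rfl
              · exact (hbm i hi hid).trans (le_max_left _ _)
              · exact le_max_right _ _
            · refine ⟨b, hb, fun i hi hid => ?_⟩
              rcases Nat.lt_succ_iff_lt_or_eq.1 hi with hi | rfl
              · exact hbm i hi hid
              · exact (hm hid).elim
        obtain ⟨b, hb, hbn⟩ := key n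
        refine ⟨b, hb, ?_⟩
        rintro _ ⟨i, rfl⟩ hid
        refine hbn i (lt_of_not_ge fun hni => ?_) hid
        exact hid.not_ge (hn.trans (le_partialSups_of_le f hni))

variable [WellFoundedLT α]

theorem exists_isLUB_of_bddAbove {s : Set α} (hs : BddAbove s) : ∃ a, IsLUB s a := by
  refine ⟨wellFounded_lt.min (upperBounds s) hs, wellFounded_lt.min_mem _ hs, fun b hb => ?_⟩
  exact wellFounded_lt.min_le hb

/-- The points closed under a monotone function form a club set. -/
theorem isClub_setOf_closed_under (hα : ℵ₀ < Order.cof α) {k : α → α} (hk : Monotone k) :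
    IsClub {b : α | ∀ x < b, k x < b} := by
  have := noMaxOrder_of_aleph0_le_cof hα.le
  refine ⟨dirSupClosed_iff_of_linearOrder.2 fun d hd _ a ha x hx => ?_, fun a => ?_⟩
  · obtain ⟨y, hy, hxy, -⟩ := ha.exists_between hx
    exact (hd hy x hxy).trans_le (ha.1 hy)
  · choose g hg using fun x : α => exists_gt (max x (k x))
    let s : ℕ → α := fun n => g^[n] a
    have hs (n : ℕ) : s (n + 1) = g (s n) := Function.iterate_succ_apply' _ _ _
    have hbdd : BddAbove (range s) :=
      .of_not_isCofinal fun h => (cof_le h).not_gt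
        (hα.trans_le' <| by simpa using mk_range_le_lift (f := s))
    obtain ⟨b, hb⟩ := exists_isLUB_of_bddAbove hbdd
    refine ⟨b, fun x hx => ?_, hb.1 ⟨0, rfl⟩⟩
    obtain ⟨_, ⟨n, rfl⟩, hxn, -⟩ := hb.exists_between hx
    calc k x ≤ k (s n) := hk hxn.le
      _ ≤ max (s n) (k (s n)) := le_max_right _ _
      _ < s (n + 1) := by rw [hs]; exact hg _
      _ ≤ b := hb.1 ⟨n + 1, rfl⟩

/-- An instance of Fodor's lemma: a regressive function on a stationary set is not injective. -/
theorem IsStationary.exists_ne_eq_of_regressive (hα : ℵ₀ < Order.cof α)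
    (hcard : ∀ a : α, #(Iic a) < Order.cof α) {T : Set α} (hT : IsStationary T) {h : α → α}
    (hreg : ∀ d ∈ T, h d < d) : ∃ d ∈ T, ∃ e ∈ T, d < e ∧ h d = h e := by
  by_contra! hinj
  have hinj' : InjOn h T := by
    intro d hd e he hde
    rcases lt_trichotomy d e with hlt | heq | hlt
    · exact (hinj d hd e he hlt hde).elim
    · exact heq
    · exact (hinj e he d hd hlt hde.symm).elim
  -- Injectivity makes the preimage of `Iic x` smaller than the cofinality, hence bounded, with
  -- supremum `k x`. A point `d ∈ T` closed under `k` then gives `d ≤ k (h d) < d`.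
  have hbdd (x : α) : BddAbove {d | d ∈ T ∧ h d ≤ x} := by
    refine .of_not_isCofinal fun hc => (cof_le hc).not_gt ((hcard x).trans_le' ?_)
    refine mk_le_of_injective (f := fun d => ⟨h d.1, d.2.2⟩) fun d e hde => ?_
    exact Subtype.ext (hinj' d.2.1 e.2.1 (congrArg Subtype.val hde))
  choose k hk using fun x => exists_isLUB_of_bddAbove (hbdd x)
  have hmono : Monotone k := fun x y hxy =>
    (hk x).mono (hk y) fun d hd => ⟨hd.1, hd.2.trans hxy⟩
  obtain ⟨d, hdT, hd⟩ := hT (isClub_setOf_closed_under hα hmono)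
  exact (hd _ (hreg d hdT)).not_ge ((hk (h d)).1 ⟨hdT, le_rfl⟩)

/-- The ladders at the points of a nonreflecting set can be separated below every point. -/
theorem exists_separating {M : Type*} [LinearOrder M] [Nonempty M] {S : Set α}
    (hlim : ∀ d ∈ S, IsSuccLimit d)
    (hS : ∀ a : α, ℵ₀ < Order.cof (Iio a) → ¬ IsStationary (traceBelow S a))
    {c : α → M → α} (hc : ∀ d ∈ S, ∀ j, c d j < d)
    (hcof : ∀ d ∈ S, ∀ x < d, ∃ i, ∀ j ≥ i, x ≤ c d j) (a : α) :
    ∃ r : α → M, ∀ d ∈ S, ∀ e ∈ S, d < e → e ≤ a → ∀ j, r d ≤ j → r e ≤ j → c d j < c e j := by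
  classical
  induction a using WellFoundedLT.induction with
  | ind a ih =>
    have hbelow : ∃ r : α → M, ∀ d ∈ S, ∀ e ∈ S, d < e → e < a → ∀ j, r d ≤ j → r e ≤ j →
        c d j < c e j := by
      obtain ⟨E, hEa, hE, hgap⟩ := exists_cofinal_nonaccumulating hlim a (hS a)
      choose! R hR using ih
      -- `E` cuts `a` into intervals, labelled by the least `n d ∈ E` at or above `d`. Within one
      -- interval the induction hypothesis at `n d` separates.
      have hnext (d : α) : ∃ n, d < a → n ∈ E ∧ d ≤ n ∧ ∀ m ∈ E, d ≤ m → n ≤ m := by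
        by_cases hd : d < a
        · obtain ⟨e, heE, hde⟩ := hE d hd
          let s : Set α := {m | m ∈ E ∧ d ≤ m}
          have hs : s.Nonempty := ⟨e, heE, hde⟩
          have hm := wellFounded_lt.min_mem s hs
          exact ⟨wellFounded_lt.min s hs, fun _ => ⟨hm.1, hm.2, fun m hm hdm =>
            wellFounded_lt.min_le (s := s) ⟨hm, hdm⟩⟩⟩
        · exact ⟨d, fun h => (hd h).elim⟩
      choose n hn using hnext
      -- From `i d` on, the ladder at `d` is at or above every point of `E` below `d`, so it clears
      -- the ladders of all earlier intervals.
      have hi (d : α) : ∃ i, d ∈ S → d < a → ∀ e ∈ E, e < d → ∀ j ≥ i, e ≤ c d j := by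
        by_cases hd : d ∈ S ∧ d < a
        · obtain ⟨b, hb, hEb⟩ := hgap d hd.1 hd.2
          obtain ⟨i, hi⟩ := hcof d hd.1 b hb
          exact ⟨i, fun _ _ e he hed j hj => (hEb e he hed).trans (hi j hj)⟩
        · exact ⟨Classical.arbitrary M, fun h h' => (hd ⟨h, h'⟩).elim⟩
      choose i hi using hi
      refine ⟨fun d => max (R (n d) d) (i d), fun d hd e he hde hea j hdj hej => ?_⟩
      obtain ⟨hdE, hdn, hdmin⟩ := hn d (hde.trans hea)
      obtain ⟨heE, hen, hemin⟩ := hn e hea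
      rcases lt_or_ge (n d) e with hlt | hge
      · exact (hc d hd j).trans_le
          (hdn.trans (hi e he hea _ hdE hlt j ((le_max_right _ _).trans hej)))
      · have hnn : n d = n e := (hdmin _ heE (hde.le.trans hen)).antisymm (hemin _ hdE hge)
        refine hR (n d) (hEa hdE) d hd e he hde hge j ((le_max_left _ _).trans hdj) ?_
        rw [hnn]
        exact (le_max_left _ _).trans hej
    obtain ⟨r, hr⟩ := hbelow
    -- The ladder at `a` itself: raising only `r d` suffices, since `c d j < d ≤ c a j` from `i d`
    -- on.
    have hi (d : α) : ∃ i, a ∈ S → d < a → ∀ j ≥ i, d ≤ c a j := by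
      by_cases hd : a ∈ S ∧ d < a
      · obtain ⟨i, hi⟩ := hcof a hd.1 d hd.2
        exact ⟨i, fun _ _ => hi⟩
      · exact ⟨Classical.arbitrary M, fun h h' => (hd ⟨h, h'⟩).elim⟩
    choose i hi using hi
    refine ⟨fun d => max (r d) (i d), fun d hd e he hde hea j hdj hej => ?_⟩
    rcases hea.lt_or_eq with hlt | rfl
    · exact hr d hd e he hde hlt j ((le_max_left _ _).trans hdj) ((le_max_left _ _).trans hej)
    · exact (hc d hd j).trans_le (hi d he hde j ((le_max_right _ _).trans hdj))

/-- A well-order whose cofinality is `μ` has a monotone cofinal `μ`-sequence. -/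
theorem exists_monotone_cofinal {μ : Cardinal.{u}} (h : Order.cof α = μ) :
    ∃ f : μ.ord.ToType → α, Monotone f ∧ ∀ x, ∃ i, x ≤ f i := by
  obtain ⟨s, hs, hs'⟩ := Ordinal.exists_ord_cof_eq α
  rw [h, ← Ordinal.type_toType μ.ord] at hs'
  obtain ⟨e⟩ := Ordinal.type_eq.1 hs'
  let f : s ≃o μ.ord.ToType := .ofRelIsoLT e
  refine ⟨fun i => f.symm i, fun i j hij => f.symm.monotone hij, fun x => ?_⟩
  obtain ⟨y, hy, hxy⟩ := hs x
  exact ⟨f ⟨y, hy⟩, by simpa using hxy⟩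

theorem exists_ladder {μ : Cardinal.{u}} {S : Set α} (hS : ∀ a ∈ S, Order.cof (Iio a) = μ) :
    ∃ c : α → μ.ord.ToType → α, (∀ d ∈ S, ∀ j, c d j < d) ∧
      ∀ d ∈ S, ∀ x < d, ∃ i, ∀ j ≥ i, x ≤ c d j := by
  have key (d : α) : ∃ c : μ.ord.ToType → α, d ∈ S →
      (∀ j, c j < d) ∧ ∀ x < d, ∃ i, ∀ j ≥ i, x ≤ c j := by
    by_cases hd : d ∈ S
    · obtain ⟨f, hf, hcof⟩ := exists_monotone_cofinal (hS d hd)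
      refine ⟨fun j => f j, fun _ => ⟨fun j => (f j).2, fun x hx => ?_⟩⟩
      obtain ⟨i, hi⟩ := hcof ⟨x, hx⟩
      exact ⟨i, fun j hj => le_trans hi (hf hj)⟩
    · exact ⟨fun _ => d, fun h => (hd h).elim⟩
  choose c hc using key
  exact ⟨c, fun d hd => (hc d hd).1, fun d hd => (hc d hd).2⟩

end WellOrder

namespace Cardinal.IsRegular

variable {κ : Cardinal.{u}}

theorem cof_ord_toType (hκ : κ.IsRegular) : Order.cof κ.ord.ToType = κ := by
  rw [Ordinal.cof_toType, hκ.cof_ord]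

theorem isRegularCardinalOrder (hκ : κ.IsRegular) : IsRegularCardinalOrder κ.ord.ToType :=
  ⟨by rw [hκ.cof_ord_toType, Ordinal.type_toType]⟩

theorem mk_Iic_lt (hκ : κ.IsRegular) (a : κ.ord.ToType) : #(Iic a) < κ := by
  have := noMaxOrder_of_aleph0_le_cof (hκ.aleph0_le.trans_eq hκ.cof_ord_toType.symm)
  obtain ⟨b, hb⟩ := exists_gt a
  have hlt : #(Iio b) < κ := by simpa using Cardinal.mk_Iio_lt b (by simp)
  exact (mk_le_mk_of_subset fun x hx => lt_of_le_of_lt hx hb).trans_lt hlt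

theorem exists_forall_lt_of_mk_lt (hκ : κ.IsRegular) {s : Set κ.ord.ToType} (hs : #s < κ) :
    ∃ b, ∀ x ∈ s, x < b := by
  refine not_isCofinal_iff.1 fun h => (cof_le h).not_gt ?_
  rwa [hκ.cof_ord_toType]

end Cardinal.IsRegular

/-! ### Failure of compactness from a nonreflecting stationary set -/

/-- A space with a `κ`-sequence without complete accumulation points is not `[κ, κ]`-compact. -/
theorem not_isBracketCompact_of_sequence {κ : Cardinal.{u}} (hκ : κ.IsRegular) {X : Type u}
    [TopologicalSpace X] (x : κ.ord.ToType → X)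
    (hx : ∀ y, ∃ U, IsOpen U ∧ y ∈ U ∧ ∃ b, ∀ a ≥ b, x a ∉ U) : ¬ IsBracketCompact κ κ X := by
  intro hcomp
  let O : κ.ord.ToType → Set X := fun b => interior (x '' Ici b)ᶜ
  have hcover : ⋃₀ range O = Set.univ := by
    refine eq_univ_of_forall fun y => ?_
    obtain ⟨U, hU, hyU, b, hb⟩ := hx y
    refine ⟨O b, ⟨b, rfl⟩, mem_interior.2 ⟨U, ?_, hU, hyU⟩⟩
    rintro z hz ⟨a, ha, rfl⟩
    exact hb a ha hz
  obtain ⟨V, hVO, hV, hcard⟩ := hcomp (range O) (by rintro _ ⟨b, rfl⟩; exact isOpen_interior)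
    hcover (mk_range_le.trans_eq (by simp))
  choose g hg using fun v : V => hVO v.2
  -- By regularity, the indices of fewer than `κ` members are bounded by some `b`, and then `x b` is
  -- in none of them.
  obtain ⟨b, hb⟩ := hκ.exists_forall_lt_of_mk_lt (s := range g) (mk_range_le.trans_lt hcard)
  have hmem : x b ∈ ⋃₀ V := hV ▸ mem_univ _
  obtain ⟨v, hv, hbv⟩ := hmem
  have hbv' : x b ∈ O (g ⟨v, hv⟩) := by rw [hg]; exact hbv
  exact interior_subset hbv' ⟨b, (hb _ ⟨_, rfl⟩).le, rfl⟩

theorem isOpen_Iic_of_noMaxOrder {α : Type*} [LinearOrder α] [WellFoundedLT α] [NoMaxOrder α]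
    [TopologicalSpace α] [OrderTopology α] (a : α) : IsOpen (Iic a) := by
  obtain ⟨b, hab⟩ := exists_gt a
  let s := Ioi a
  have hs : s.Nonempty := ⟨b, hab⟩
  have : Iic a = Iio (wellFounded_lt.min s hs) := by
    ext x
    refine ⟨fun hx => lt_of_le_of_lt hx (wellFounded_lt.min_mem s hs), fun hx => ?_⟩
    exact le_of_not_gt fun h => (wellFounded_lt.min_le (s := s) h).not_gt hx
  rw [this]
  exact isOpen_Iio

theorem PrincipleE.not_isBracketCompact {μ κ : Cardinal.{u}} (hμ : μ.IsRegular)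
    (hκ : κ.IsRegular) (hμκ : μ < κ) (hE : PrincipleE μ κ) :
    ¬ IsBracketCompact κ κ (CardinalPower μ κ) := by
  obtain ⟨S, ⟨hstat, hnr⟩, hcof⟩ := hE
  have hα : ℵ₀ < Order.cof κ.ord.ToType := by
    rw [hκ.cof_ord_toType]
    exact hμ.aleph0_le.trans_lt hμκ
  have hne : Nonempty μ.ord.ToType := nonempty_ord_toType hμ.ne_zero
  have hnm : NoMaxOrder μ.ord.ToType := Cardinal.noMaxOrder hμ.aleph0_le
  have hlim (d) (hd : d ∈ S) : IsSuccLimit d :=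
    isSuccLimit_of_aleph0_le_cof_Iio (hμ.aleph0_le.trans_eq (hcof d hd).symm)
  obtain ⟨c, hc, hcc⟩ := exists_ladder hcof
  choose r hr using exists_separating hlim hnr hc hcc
  refine not_isBracketCompact_of_sequence hκ r fun y => ?_
  have hunion : IsStationary (⋃ j, {d | d ∈ S ∧ y d = j}) := by
    refine hstat.mono fun d hd => mem_iUnion.2 ⟨y d, hd, rfl⟩
  rw [isStationary_iUnion_iff hα.ne' (by simpa [hκ.cof_ord_toType] using hμκ)] at hunion
  obtain ⟨j, hj⟩ := hunion
  obtain ⟨d, ⟨hd, hdj⟩, e, ⟨he, hej⟩, hde, heq⟩ := hj.exists_ne_eq_of_regressive hα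
    (fun a => (hκ.mk_Iic_lt a).trans_eq hκ.cof_ord_toType.symm) (h := fun d => c d j)
    fun d hd => hc d hd.1 j
  -- Initial segments replace singletons because a limit value of `y` is not isolated in `μ`.
  refine ⟨{z | z d ≤ y d} ∩ {z | z e ≤ y e}, ?_, ⟨le_refl (y d), le_refl (y e)⟩, e, fun a ha hra => ?_⟩
  · have hopen (d) : IsOpen {z : CardinalPower μ κ | z d ≤ y d} :=
      (isOpen_Iic_of_noMaxOrder (y d)).preimage
        (continuous_apply d : Continuous fun z : CardinalPower μ κ => z d)
    exact (hopen d).inter (hopen e)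
  · exact (hr a d hd e he hde ha j (hdj ▸ hra.1) (hej ▸ hra.2)).ne heq

/-! ### Nonreflecting stationary sets from square -/

/-- The ordinals of cofinality `μ` form a stationary subset of every larger regular cardinal. -/
theorem isStationary_setOf_cof_eq {μ κ : Cardinal.{u}} (hμ : μ.IsRegular) (hκ : κ.IsRegular)
    (hμκ : μ < κ) : IsStationary {a : κ.ord.ToType | Order.cof (Iio a) = μ} := by
  intro t ht
  have := hκ.isRegularCardinalOrder
  have hf := IsClub.isNormal_enum ht
  set f : κ.ord.ToType → κ.ord.ToType := Subtype.val ∘ Order.enum t ht.isCofinal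
  let m : κ.ord.ToType := Ordinal.ToType.mk ⟨μ.ord, ord_lt_ord.2 hμκ⟩
  have hm : Order.cof (Iio m) = μ := by
    rw [← Ordinal.cof_type, Ordinal.type_Iio_lt]
    exact (congrArg Ordinal.cof (Ordinal.typein_enum _ _)).trans hμ.cof_ord
  have hlim : IsSuccLimit m := isSuccLimit_of_aleph0_le_cof_Iio (hμ.aleph0_le.trans_eq hm.symm)
  -- The enumeration of the club is normal, so its value at the ordinal `μ` again has cofinality
  -- `μ`.
  refine ⟨f m, ?_, (Order.enum t ht.isCofinal m).2⟩
  rw [mem_ofPred_eq, ← hm]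
  refine (cof_congr_of_strictMono (f := fun x : Iio m => (⟨f x, hf.strictMono x.2⟩ : Iio (f m)))
    (fun x y hxy => hf.strictMono hxy) ?_).symm
  rintro ⟨x, hx⟩
  obtain ⟨y, hy, hxy⟩ := (hf.lt_iff_exists_lt hlim).1 hx
  exact ⟨_, ⟨⟨y, hy⟩, rfl⟩, hxy.le⟩

/-- Pigeonhole fixes the order type of `C a` on a stationary set of points of cofinality `μ`.
Reflection at `a` would give two such points `b < e` that are limit points of `C a`; by coherence `C
b` is a proper initial segment of `C e`, so their order types differ. -/
theorem SquarePrinciple.principleE {κ μ : Cardinal.{u}} (hκ : ℵ₀ ≤ κ) (hsq : SquarePrinciple κ)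
    (hμ : μ.IsRegular) (hμκ : μ ≤ κ) : PrincipleE μ (succ κ) := by
  obtain ⟨C, hC⟩ := hsq
  have hreg := isRegular_succ hκ
  have hα : ℵ₀ < Order.cof (succ κ).ord.ToType := by
    rw [hreg.cof_ord_toType]
    exact hκ.trans_lt (lt_succ κ)
  let ot (a : (succ κ).ord.ToType) : Ordinal.{u} := Ordinal.type fun x y : C a => x < y
  have hlim (a : (succ κ).ord.ToType) (ha : Order.cof (Iio a) = μ) : IsSuccLimit a :=
    isSuccLimit_of_aleph0_le_cof_Iio (hμ.aleph0_le.trans_eq ha.symm)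
  -- The order type may equal `κ.ord`, hence the index set `succ κ.ord`, which still has cardinality
  -- below `succ κ`.
  have hunion : IsStationary (⋃ i : (succ κ.ord).ToType,
      {a | Order.cof (Iio a) = μ ∧ ot a = Ordinal.ToType.toOrd i}) := by
    refine (isStationary_setOf_cof_eq hμ hreg (lt_succ_of_le hμκ)).mono fun a ha => ?_
    have hle : ot a ≤ κ.ord := (hC a (hlim a ha)).2.2.1
    exact mem_iUnion.2 ⟨Ordinal.ToType.mk ⟨ot a, lt_succ_of_le hle⟩, ha, by simp⟩
  rw [isStationary_iUnion_iff hα.ne'] at hunion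
  swap
  · rw [hreg.cof_ord_toType, lift_lt, mk_toType]
    rw [← lt_ord]
    exact (Cardinal.isSuccLimit_ord (hκ.trans (le_succ κ))).succ_lt (ord_lt_ord.2 (lt_succ κ))
  obtain ⟨i, hi⟩ := hunion
  refine ⟨_, ⟨hi, fun a ha hrefl => ?_⟩, fun a ha => ha.1⟩
  obtain ⟨hCa, hclub, -, hcoh⟩ := hC a (isSuccLimit_of_aleph0_le_cof_Iio ha.le)
  have := noMaxOrder_of_aleph0_le_cof ha.le
  -- the points closed under the successor function of `C a` are limit points of `C a`
  have hnext (x : Iio a) : ∃ y, x < y ∧ (y : (succ κ).ord.ToType) ∈ C a ∧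
      ∀ z, x < z → (z : (succ κ).ord.ToType) ∈ C a → y ≤ z := by
    obtain ⟨w, hw⟩ := exists_gt x
    obtain ⟨z, hz, hwz⟩ := hclub.isCofinal w
    let s : Set (Iio a) := {z | x < z ∧ (z : (succ κ).ord.ToType) ∈ C a}
    have hs : s.Nonempty := ⟨z, hw.trans_le hwz, hz⟩
    have hmin := wellFounded_lt.min_mem s hs
    exact ⟨wellFounded_lt.min s hs, hmin.1, hmin.2, fun z hz hzC =>
      wellFounded_lt.min_le (s := s) ⟨hz, hzC⟩⟩
  choose k hk hkC hkmin using hnext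
  have hmono : Monotone k := by
    intro x y hxy
    exact hkmin x _ (hxy.trans_lt (hk y)) (hkC y)
  have hD := isClub_setOf_closed_under ha hmono
  have hlimpt (b : Iio a) (hb : ∀ x < b, k x < b) (hbμ : Order.cof (Iio b.1) = μ) :
      C b = C a ∩ Iio b.1 := by
    refine hcoh b b.2 ⟨hlim _ hbμ, fun x hx => ?_⟩
    exact ⟨k ⟨x, hx.trans b.2⟩, hkC _, hk ⟨x, hx.trans b.2⟩, hb ⟨x, hx.trans b.2⟩ hx⟩
  obtain ⟨b, ⟨hbμ, hbot⟩, hbD⟩ := hrefl hD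
  have hD' : IsClub ({b : Iio a | ∀ x < b, k x < b} ∩ Ioi b) := by
    refine hD.inter ha.ne' ⟨(isUpperSet_Ioi b).dirSupClosed, fun x => ?_⟩
    obtain ⟨y, hy⟩ := exists_gt (max x b)
    exact ⟨y, (le_max_right _ _).trans_lt hy, ((le_max_left _ _).trans_lt hy).le⟩
  obtain ⟨e, ⟨heμ, heot⟩, heD, hbe⟩ := hrefl hD'
  have hCb := hlimpt b hbD hbμ
  have hCe := hlimpt e heD heμ
  have hlt : ot b < ot e := by
    -- The next point `k b` of `C a` after `b` lies in `C e` above all of `C b`, which makes the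
    -- inclusion proper.
    have hkb : (k b : (succ κ).ord.ToType) ∈ C e := by
      rw [hCe]
      exact ⟨hkC b, heD b hbe⟩
    have hmem (x : C b) : x.1 ∈ C e ∧ x.1 < k b := by
      obtain ⟨x, hx⟩ := x
      rw [hCb] at hx
      rw [hCe]
      have hbe' : b.1 < e.1 := hbe
      have hxb : x < b.1 := hx.2
      exact ⟨⟨hx.1, hxb.trans hbe'⟩, hxb.trans (hk b)⟩
    refine lt_of_le_of_lt ?_ (Ordinal.typein_lt_type (fun x y : C e => x < y) ⟨k b, hkb⟩)
    rw [← Ordinal.type_subrel]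
    let g (x : C b) : {x : C e // x < ⟨k b, hkb⟩} := ⟨⟨x.1, (hmem x).1⟩, (hmem x).2⟩
    exact (RelEmbedding.ofMonotone (r := fun x y : C b => x < y)
      (s := Subrel (fun x y : C e => x < y) (· < ⟨k b, hkb⟩)) g
      fun x y hxy => hxy).ordinal_type_le
  rw [hbot, heot] at hlt
  exact hlt.false

theorem mainTheorem6 :
    (∀ μ κ : Cardinal.{u}, μ.IsRegular → κ.IsRegular → μ < κ → PrincipleE μ κ →
      ¬ IsBracketCompact κ κ (CardinalPower μ κ)) ∧
    (∀ κ : Cardinal.{u}, ℵ₀ ≤ κ → SquarePrinciple κ →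
      ∀ μ : Cardinal.{u}, μ.IsRegular → μ ≤ κ →
        ¬ IsBracketCompact (succ κ) (succ κ) (CardinalPower μ (succ κ))) :=
  ⟨fun _ _ hμ hκ hμκ hE => hE.not_isBracketCompact hμ hκ hμκ,
    fun _ hκ hsq _ hμ hμκ => (hsq.principleE hκ hμ hμκ).not_isBracketCompact hμ (isRegular_succ hκ)
      (lt_succ_of_le hμκ)⟩
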